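/- Let $d\ge 1$, let $D\subseteq\mathbb R^d$, and let $G:D\times D\to\mathbb R$ be a continuous covariance kernel (symmetric and positive semi-definite), i.e. the continuous covariance kernel of a centered Gaussian process on $D$. Let $\mathcal C\subseteq D$ be a nonempty compact Lipschitz $(d-1)$-manifold, possibly with boundary, in the sense that every point of $\mathcal C$ has a relatively open neighbourhood in $\mathcal C$ which is bi-Lipschitz equivalent to a relatively open subset of $\mathbb R^{d-1}$ or of a closed half-space of $\mathbb R^{d-1}$. Let $\mathcal H^{d-1}$ be the $(d-1)$-dimensional Hausdorff measure on $\mathbb R^d$, normalized to agree with Lebesgue measure on $\mathbb R^{d-1}$. Then $0<\mathcal H^{d-1}(\mathcal C)<\infty$, so that $$\mu=\frac{\mathcal H^{d-1}|_{\mathcal C}}{\mathcal H^{d-1}(\mathcal C)}$$ is a probability measure on $\mathcal C$. Let $(\lambda_n,\phi_n)$ be positive eigenvalues with $L^2(\mathcal C,\mu)$-orthonormal eigenfunctions of the operator $T[h](x)=\int_{\mathcal C}G(x,y)h(y)\,d\mu(y)$ on $L^2(\mathcal C,\mu)$ (for instance those of the Karhunen–Loève expansion, with respect to $\mu$, of the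 Gaussian process restricted to $\mathcal C$), and let $$\widehat\phi_n(x)=\frac1{\lambda_n}\int_{\mathcal C}G(x,y)\,\phi_n(y)\,d\mu(y),\qquad x\in D,$$ be their liftings to $D$. Let $\Gamma\subseteq\mathbb R^{p}$, $p=d-1$, be Lebesgue measurable and let $\gamma:\Gamma\to\mathbb R^d$ be Lipschitz and injective with $\gamma(\Gamma)=\mathcal C$. Then the Jacobian matrix $J_\gamma(s)\in\mathbb R^{d\times p}$ is well defined for almost every $s\in\Gamma$, and for all $n$ and all $x\in D$ (all the integrals converging absolutely) $$\widehat\phi_n(x)=\frac1{\lambda_n}\int_\Gamma G(x,\gamma(s))\,\phi_n(\gamma(s))\,\sqrt{\det\big(J_\gamma(s)^{\mathsf T}J_\gamma(s)\big)}\;\frac{ds}{\mathcal H^{d-1}(\mathcal C)} .$$ In particular the right-hand side is the same for any two such parameterizations $(\Gamma_1,\gamma_1)$ and $(\Gamma_2,\gamma_2)$ of $\mathcal C$. -/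

import Mathlib

open MeasureTheory Set
open scoped NNReal ENNReal Matrix

noncomputable section

/-- Euclidean space `ℝ^m`. -/
abbrev Euc (m : ℕ) : Type := EuclideanSpace ℝ (Fin m)

/-- `G` restricts to a continuous covariance kernel on `D`: a continuous function on `D × D` that is
symmetric and positive semi-definite. The values of `G` outside `D × D` play no role. -/
structure IsContinuousCovarianceKernelOn {d : ℕ} (G : Euc d → Euc d → ℝ) (D : Set (Euc d)) :
    Prop where
  continuousOn : ContinuousOn (fun z : Euc d × Euc d => G z.1 z.2) (D ×ˢ D)
  posSemidef : Matrix.PosSemidef (Matrix.of fun x y : D => G x y)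

/-- `C ⊆ ℝ^d` is a Lipschitz `p`-manifold, possibly with boundary: around each of its points there
is a relatively open piece of `C` that is the bi-Lipschitz image of a relatively open subset of a
closed half-space of `ℝ^p`, or of `ℝ^p` itself (the case `a = 0`). -/
def IsLipschitzManifold {d : ℕ} (p : ℕ) (C : Set (Euc d)) : Prop :=
  ∀ x ∈ C, ∃ (U : Set (Euc d)) (V : Set (Euc p)) (a : Euc p) (ψ : Euc p → Euc d) (K L : ℝ≥0),
    IsOpen U ∧ x ∈ U ∧ IsOpen V ∧
    ψ '' (V ∩ {y | 0 ≤ inner ℝ a y}) = C ∩ U ∧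
    ∀ y ∈ V ∩ {y | 0 ≤ inner ℝ a y}, ∀ z ∈ V ∩ {y | 0 ≤ inner ℝ a y},
      dist (ψ y) (ψ z) ≤ K * dist y z ∧ dist y z ≤ L * dist (ψ y) (ψ z)

/-- `γ : Γ → C` is an injective Lipschitz parameterization of `C`, with domain the Lebesgue
measurable set `Γ ⊆ ℝ^p`. The values of `γ` outside `Γ` play no role. -/
structure IsInjLipschitzParam {d p : ℕ} (C : Set (Euc d)) (Γ : Set (Euc p)) (γ : Euc p → Euc d) :
    Prop where
  measurable_domain : NullMeasurableSet Γ volume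
  lipschitz : ∃ K : ℝ≥0, LipschitzOnWith K γ Γ
  injOn : InjOn γ Γ
  image_eq : γ '' Γ = C

/-- The `d × p` Jacobian matrix of `γ : Γ → ℝ^d` at `s`. -/
def jacobianMatrix {d p : ℕ} (γ : Euc p → Euc d) (Γ : Set (Euc p)) (s : Euc p) :
    Matrix (Fin d) (Fin p) ℝ :=
  Matrix.of fun i j => fderivWithin ℝ γ Γ s (EuclideanSpace.single j 1) i

/-- The normalized surface measure `H^{d-1} / H^{d-1}(C)` on `C`; here `μHE[m]` is the
`m`-dimensional Hausdorff measure, normalized to agree with Lebesgue measure on `ℝ^m`. -/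
def normalizedSurfaceMeasure {d : ℕ} (C : Set (Euc d)) : Measure (Euc d) :=
  (μHE[d - 1] C)⁻¹ • (μHE[d - 1] : Measure (Euc d)).restrict C

/-- `(lam n, φ n)` are positive eigenvalues and orthonormal eigenfunctions in `L²(μ)` of the
integral operator `h ↦ ∫ G(·, y) h(y) dμ(y)` on `L²(μ)`. -/
structure IsOrthonormalEigensystem {d : ℕ} {ι : Type*} (G : Euc d → Euc d → ℝ)
    (μ : Measure (Euc d)) (lam : ι → ℝ) (φ : ι → Euc d → ℝ) : Prop where
  eigenvalue_pos : ∀ n, 0 < lam n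
  memLp : ∀ n, MemLp (φ n) 2 μ
  norm_one : ∀ n, ∫ y, φ n y ^ 2 ∂μ = 1
  orthogonal : ∀ m n, m ≠ n → ∫ y, φ m y * φ n y ∂μ = 0
  eigen : ∀ n, ∀ᵐ x ∂μ, ∫ y, G x y * φ n y ∂μ = lam n * φ n x

/-- The lifting of an eigenfunction `φ`, of eigenvalue `lam`, from `C` to the whole domain. -/
def lifting {d : ℕ} (G : Euc d → Euc d → ℝ) (μ : Measure (Euc d)) (lam : ℝ) (φ : Euc d → ℝ)
    (x : Euc d) : ℝ :=
  1 / lam * ∫ y, G x y * φ y ∂μ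

/-- The integrand `G(x, γ(s)) φ(γ(s)) √det(J_γ(s)ᵀ J_γ(s)) / H^{d-1}(C)`. -/
def surfaceIntegrand {d p : ℕ} (G : Euc d → Euc d → ℝ) (C : Set (Euc d)) (φ : Euc d → ℝ)
    (Γ : Set (Euc p)) (γ : Euc p → Euc d) (x : Euc d) (s : Euc p) : ℝ :=
  G x (γ s) * φ (γ s) * √((jacobianMatrix γ Γ s)ᵀ * jacobianMatrix γ Γ s).det
    / (μHE[d - 1] C).toReal

end

/-! The formula is a change of variables. By the area formula, an injective Lipschitz `γ` pushes the
measure with density `normDet` of its derivative on `Γ` forward to Hausdorff measure on `C`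
(`LipschitzOnWith.map_withDensity_normDet`), and `√det(JᵀJ)` is that `normDet`
(`sqrt_det_jacobianMatrix`). Independence of the parameterization follows, since the surface
integral does not mention `γ`.

For the area formula, cut the domain into countably many pieces on which the map is close to a
linear map `A`. There the measure of the image is nearly `normDet A` times the volume
(`exists_area_estimates`), and at density points the derivative is close to `A`. Sum over the pieces
and let the error tend to 0. Rademacher's theorem reduces the Lipschitz case to the differentiable
one.

The total mass is positive and finite because the charts are Lipschitz in both directions. -/

open Filter Metric Module Topology
open scoped Pointwise Function

/-! ### Density points and derivatives within a set -/

section Density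

variable {E F : Type*} [NormedAddCommGroup E] [NormedSpace ℝ E] [FiniteDimensional ℝ E]
  [MeasurableSpace E] [BorelSpace E] [NormedAddCommGroup F] [NormedSpace ℝ F]

/-- Near a density point, every small rescaling `x + r • B` of a ball `B` around `z` meets `s`.
Shrinking `B` and `r` together yields points of `s` that approach `x` in direction `z`. -/
theorem tangentConeAt_eq_univ_of_density_one (μ : Measure E) [μ.IsAddHaarMeasure] {s : Set E}
    {x : E} (h : Tendsto (fun r => μ (s ∩ closedBall x r) / μ (closedBall x r)) (𝓝[>] 0) (𝓝 1)) :
    tangentConeAt ℝ s x = univ := by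
  refine eq_univ_of_forall fun z => ?_
  have key : ∀ n : ℕ, ∃ r : ℝ, ∃ a : E, 0 < r ∧ r < 1 / ((n : ℝ) + 1) ∧
      dist a z ≤ 1 / ((n : ℝ) + 1) ∧ x + r • a ∈ s := by
    intro n
    have hn : (0 : ℝ) < 1 / ((n : ℝ) + 1) := by positivity
    have h1 := Measure.eventually_nonempty_inter_smul_of_density_one μ s x h
      (closedBall z (1 / ((n : ℝ) + 1))) measurableSet_closedBall
      (measure_closedBall_pos μ z hn).ne'
    obtain ⟨r, ⟨y, ys, hy⟩, hr⟩ := (h1.and (Ioo_mem_nhdsGT hn)).exists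
    rw [singleton_add, mem_image] at hy
    obtain ⟨w, ⟨a, ha, rfl⟩, rfl⟩ := hy
    exact ⟨r, a, hr.1, hr.2, ha, ys⟩
  choose r a r0 rlt ha hs using key
  have lim : Tendsto (fun n : ℕ => 1 / ((n : ℝ) + 1)) atTop (𝓝 0) :=
    tendsto_one_div_add_atTop_nhds_zero_nat
  have alim : Tendsto a atTop (𝓝 z) :=
    tendsto_iff_dist_tendsto_zero.2 (squeeze_zero (fun _ => dist_nonneg) ha lim)
  have rlim : Tendsto r atTop (𝓝 0) := squeeze_zero (fun n => (r0 n).le) (fun n => (rlt n).le) lim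
  refine mem_tangentConeAt_of_seq atTop (fun n => (r n)⁻¹) (fun n => r n • a n) ?_
    (Eventually.of_forall hs) ?_
  · simpa using rlim.smul alim
  · refine alim.congr fun n => ?_
    rw [inv_smul_smul₀ (r0 n).ne']

theorem ae_tangentConeAt_eq_univ (μ : Measure E) [μ.IsAddHaarMeasure] (s : Set E) :
    ∀ᵐ x ∂μ.restrict s, tangentConeAt ℝ s x = univ := by
  filter_upwards [Besicovitch.ae_tendsto_measure_inter_div μ s] with x hx
  exact tangentConeAt_eq_univ_of_density_one μ hx

omit [FiniteDimensional ℝ E] [MeasurableSpace E] [BorelSpace E] in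
theorem uniqueDiffWithinAt_of_tangentConeAt_eq_univ {s : Set E} {x : E}
    (h : tangentConeAt ℝ s x = univ) : UniqueDiffWithinAt ℝ s x where
  dense_tangentConeAt := by simp [h]
  mem_closure := zero_mem_tangentConeAt_iff.1 (h ▸ mem_univ (0 : E))

-- Each `z` is a limit of rescaled increments within `s`. Along them the difference quotients of `f`
-- tend to `f' z` and stay within `δ ‖z‖` of `A z` in the limit.
omit [FiniteDimensional ℝ E] [MeasurableSpace E] [BorelSpace E] in
theorem norm_fderiv_sub_le_of_tangentConeAt_eq_univ {s : Set E} {x : E} {f : E → F}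
    {f' A : E →L[ℝ] F} {δ : ℝ≥0} (hx : tangentConeAt ℝ s x = univ) (xs : x ∈ s)
    (hf : ApproximatesLinearOn f A s δ) (hf' : HasFDerivWithinAt f f' s x) : ‖f' - A‖ ≤ δ := by
  refine ContinuousLinearMap.opNorm_le_bound _ δ.2 fun z => ?_
  obtain ⟨c, d, hc, hd, hcd⟩ :=
    mem_tangentConeAt_iff_exists_seq_norm_tendsto_atTop.1 (hx ▸ mem_univ z)
  have hd0 : Tendsto d atTop (𝓝 0) := tangentConeAt.lim_zero atTop hc hcd
  have hlim : Tendsto (fun n => c n • (f (x + d n) - f x)) atTop (𝓝 (f' z)) :=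
    hf'.lim hd0 hd hcd
  have hA : Tendsto (fun n => A (c n • d n)) atTop (𝓝 (A z)) := (A.continuous.tendsto z).comp hcd
  refine le_of_tendsto_of_tendsto (hlim.sub hA).norm (hcd.norm.const_mul (δ : ℝ)) ?_
  filter_upwards [hd] with n hn
  have := hf (x + d n) hn x xs
  rw [add_sub_cancel_left] at this
  rw [map_smul, ← smul_sub, norm_smul, norm_smul, mul_left_comm]
  gcongr

end Density

/-! ### Continuity of the Jacobian factor -/

section NormDet

variable {E F : Type*} [NormedAddCommGroup E] [InnerProductSpace ℝ E] [FiniteDimensional ℝ E]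
  [NormedAddCommGroup F] [InnerProductSpace ℝ F]

theorem continuous_normDet [CompleteSpace F] :
    Continuous fun A : E →L[ℝ] F => A.toLinearMap.normDet := by
  have h : ∀ A : E →L[ℝ] F, A.toLinearMap.normDet = √((A.adjoint ∘L A).det) := fun A => by
    rw [← A.normDet_sq, RCLike.ofReal_real_eq_id, id, Real.sqrt_sq A.toLinearMap.normDet_nonneg]
  simp_rw [h]
  refine Real.continuous_sqrt.comp (ContinuousLinearMap.continuous_det.comp ?_)
  exact (ContinuousLinearMap.adjoint (𝕜 := ℝ) (E := E) (F := F)).continuous.clm_comp continuous_id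

end NormDet

/-! ### Comparison of Hausdorff measures of images -/

section Comparison

variable {α X Y : Type*} [MetricSpace X] [MeasurableSpace X] [BorelSpace X]
  [MetricSpace Y] [MeasurableSpace Y] [BorelSpace Y]

/-- The hypothesis makes `g x ↦ f x` a well-defined `K`-Lipschitz map on `g '' s`, even if `g` is
not injective. -/
theorem euclideanHausdorffMeasure_image_le_of_dist_le {f : α → X} {g : α → Y} {s : Set α}
    {K : ℝ≥0} (n : ℕ) (h : ∀ x ∈ s, ∀ y ∈ s, dist (f x) (f y) ≤ K * dist (g x) (g y)) :
    μHE[n] (f '' s) ≤ (K : ℝ≥0∞) ^ n * μHE[n] (g '' s) := by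
  rcases s.eq_empty_or_nonempty with rfl | ⟨x₀, hx₀⟩
  · simp
  have : Nonempty α := ⟨x₀⟩
  let k : Y → X := fun y => f (Function.invFunOn g s y)
  have hk : ∀ x ∈ s, k (g x) = f x := fun x hx => by
    have h1 : Function.invFunOn g s (g x) ∈ s := Function.invFunOn_mem ⟨x, hx, rfl⟩
    have h2 : g (Function.invFunOn g s (g x)) = g x := Function.invFunOn_eq ⟨x, hx, rfl⟩
    refine dist_le_zero.1 ((h _ h1 _ hx).trans ?_)
    simp [h2]
  have hlip : LipschitzOnWith K k (g '' s) := by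
    refine LipschitzOnWith.of_dist_le_mul ?_
    rintro _ ⟨x, hx, rfl⟩ _ ⟨y, hy, rfl⟩
    rw [hk x hx, hk y hy]
    exact h x hx y hy
  have him : f '' s = k '' (g '' s) := by
    rw [image_image]
    exact image_congr fun x hx => (hk x hx).symm
  rw [him]
  simp_rw [Measure.euclideanHausdorffMeasure_def, Measure.smul_apply, Measure.nnreal_smul_coe_apply]
  rw [mul_left_comm]
  gcongr
  simpa using hlip.hausdorffMeasure_image_le (d := (n : ℝ)) (by positivity)

theorem LipschitzOnWith.euclideanHausdorffMeasure_image_le {f : Y → X} {s : Set Y} {K : ℝ≥0}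
    (hf : LipschitzOnWith K f s) (n : ℕ) : μHE[n] (f '' s) ≤ (K : ℝ≥0∞) ^ n * μHE[n] s := by
  simpa using euclideanHausdorffMeasure_image_le_of_dist_le (g := id) n
    fun x hx y hy => hf.dist_le_mul x hx y hy

end Comparison

/-! ### Images under almost linear maps -/

section AreaEstimates

variable {E F : Type*} [NormedAddCommGroup E] [InnerProductSpace ℝ E] [FiniteDimensional ℝ E]
  [MeasurableSpace E] [BorelSpace E] [NormedAddCommGroup F] [InnerProductSpace ℝ F]

/-- The linear map `x ↦ (A x, η x)`. -/
noncomputable def graphPerturbation (A : E →L[ℝ] F) (η : ℝ) : E →L[ℝ] WithLp 2 (F × E) :=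
  (WithLp.prodContinuousLinearEquiv 2 ℝ F E).symm.toContinuousLinearMap ∘L
    (A.prod (η • ContinuousLinearMap.id ℝ E))

omit [FiniteDimensional ℝ E] [MeasurableSpace E] [BorelSpace E] in
theorem norm_graphPerturbation_sq (A : E →L[ℝ] F) (η : ℝ) (x : E) :
    ‖graphPerturbation A η x‖ ^ 2 = ‖A x‖ ^ 2 + (η * ‖x‖) ^ 2 := by
  rw [WithLp.prod_norm_sq_eq_of_L2]
  simp [graphPerturbation, norm_smul, mul_pow]

omit [MeasurableSpace E] [BorelSpace E] in
theorem normDet_graphPerturbation_zero (A : E →L[ℝ] F) :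
    (graphPerturbation A 0).toLinearMap.normDet = A.toLinearMap.normDet := by
  let b := stdOrthonormalBasis ℝ E
  rw [← sq_eq_sq₀ (LinearMap.normDet_nonneg _) (LinearMap.normDet_nonneg _)]
  have h1 := (graphPerturbation A 0).toLinearMap.normDet_sq_eq_det_gram b
  have h2 := A.toLinearMap.normDet_sq_eq_det_gram b
  simp only [RCLike.ofReal_real_eq_id, id] at h1 h2
  rw [h1, h2]
  congr 1
  ext i j
  simp [Matrix.gram, graphPerturbation]

omit [MeasurableSpace E] [BorelSpace E] in
theorem tendsto_normDet_graphPerturbation [FiniteDimensional ℝ F] (A : E →L[ℝ] F) :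
    Tendsto (fun η : ℝ => (graphPerturbation A η).toLinearMap.normDet) (𝓝 0)
      (𝓝 A.toLinearMap.normDet) := by
  rw [← normDet_graphPerturbation_zero A]
  refine (Continuous.tendsto ?_ 0)
  refine continuous_normDet.comp ?_
  unfold graphPerturbation
  refine continuous_const.clm_comp ?_
  have : (fun η : ℝ => A.prod (η • ContinuousLinearMap.id ℝ E)) = fun η : ℝ =>
      A.prod 0 + η • (0 : E →L[ℝ] F).prod (ContinuousLinearMap.id ℝ E) := by
    ext η x <;> simp
  rw [this]
  fun_prop

variable [FiniteDimensional ℝ F] [MeasurableSpace F] [BorelSpace F]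

/-- Since `A` may have a kernel, distances of `f` cannot be bounded by those of `A`. They are
compared with the injective map `x ↦ (A x, η x)`, whose `normDet` tends to that of `A` as `η → 0`.
-/
theorem exists_euclideanHausdorffMeasure_image_le (A : E →L[ℝ] F) {m : ℝ}
    (hm : A.toLinearMap.normDet < m) :
    ∃ δ > (0 : ℝ≥0), ∀ (s : Set E) (f : E → F), ApproximatesLinearOn f A s δ →
      μHE[finrank ℝ E] (f '' s) ≤ ENNReal.ofReal m * volume s := by
  have hlim : Tendsto (fun η : ℝ => (1 + η ^ 2) ^ finrank ℝ E *
      (graphPerturbation A η).toLinearMap.normDet) (𝓝[>] 0) (𝓝 A.toLinearMap.normDet) := by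
    have h1 : Tendsto (fun η : ℝ => (1 + η ^ 2) ^ finrank ℝ E) (𝓝 0) (𝓝 1) := by
      have : Continuous fun η : ℝ => (1 + η ^ 2) ^ finrank ℝ E := by fun_prop
      simpa using this.tendsto 0
    simpa using (h1.mul (tendsto_normDet_graphPerturbation A)).mono_left nhdsWithin_le_nhds
  obtain ⟨η, hη, η0⟩ := ((hlim.eventually_lt_const hm).and self_mem_nhdsWithin).exists
  replace η0 : 0 < η := η0
  -- The precision `η ^ 2` makes the error `η * (η * ‖x - y‖)`, which is `η` times the second
  -- component of the graph map; hence the Lipschitz constant `1 + η ^ 2`.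
  refine ⟨.mk (η ^ 2) (by positivity), NNReal.coe_pos.1 (pow_pos η0 2),
    fun s f hf => ?_⟩
  have hK : ∀ x ∈ s, ∀ y ∈ s, dist (f x) (f y) ≤
      (NNReal.mk (1 + η ^ 2) (by positivity)) *
        dist (graphPerturbation A η x) (graphPerturbation A η y) := by
    intro x hx y hy
    rw [dist_eq_norm, dist_eq_norm, ← map_sub]
    have h1 : ‖f x - f y‖ ≤ ‖A (x - y)‖ + η ^ 2 * ‖x - y‖ := by
      have h2 := hf x hx y hy
      calc ‖f x - f y‖ = ‖A (x - y) + (f x - f y - A (x - y))‖ := by abel_nf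
        _ ≤ _ := (norm_add_le _ _).trans (by gcongr; exact h2)
    refine h1.trans (abs_le_of_sq_le_sq' ?_ (by positivity)).2
    change _ ≤ ((1 + η ^ 2) * _) ^ 2
    rw [mul_pow, norm_graphPerturbation_sq]
    set a := ‖A (x - y)‖
    set b := ‖x - y‖
    nlinarith [mul_nonneg (sq_nonneg η) (sq_nonneg (a - b)),
      mul_nonneg (sq_nonneg η) (add_nonneg (sq_nonneg a) (sq_nonneg (η * b))),
      mul_nonneg (mul_nonneg (sq_nonneg η) (sq_nonneg η)) (add_nonneg (sq_nonneg a) (sq_nonneg (η * b)))]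
  refine (euclideanHausdorffMeasure_image_le_of_dist_le (finrank ℝ E) hK).trans ?_
  have := (graphPerturbation A η).toLinearMap.euclideanHausdorffMeasure_image_eq_normDet_mul_volume s
  rw [ContinuousLinearMap.coe_coe] at this
  rw [this, ← mul_assoc]
  gcongr
  rw [← ENNReal.ofReal_coe_nnreal, ← ENNReal.ofReal_pow (by positivity),
    ← ENNReal.ofReal_mul (by positivity)]
  exact ENNReal.ofReal_le_ofReal hη.le

-- If `m > 0` then `A` is injective, hence `κ`-antilipschitz. An error `δ ‖x - y‖` is at most `δ κ
-- ‖A (x - y)‖`, so `A` is controlled by `f` with constant `(1 - δ κ)⁻¹`.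
omit [FiniteDimensional ℝ F] in
theorem exists_le_euclideanHausdorffMeasure_image (A : E →L[ℝ] F) {m : ℝ}
    (hm : m < A.toLinearMap.normDet) :
    ∃ δ > (0 : ℝ≥0), ∀ (s : Set E) (f : E → F), ApproximatesLinearOn f A s δ →
      ENNReal.ofReal m * volume s ≤ μHE[finrank ℝ E] (f '' s) := by
  rcases le_or_gt m 0 with hm0 | hm0
  · exact ⟨1, one_pos, fun s f _ => by simp [ENNReal.ofReal_of_nonpos hm0]⟩
  have hker : A.toLinearMap.ker = ⊥ := by
    by_contra h
    exact (hm0.trans hm).ne' (LinearMap.normDet_eq_zero_iff_ker_ne_bot.2 h)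
  obtain ⟨κ, κ0, hκ⟩ := A.toLinearMap.exists_antilipschitzWith hker
  have hlim : Tendsto (fun δ : ℝ => (1 - δ * κ) ^ finrank ℝ E * A.toLinearMap.normDet)
      (𝓝[>] 0) (𝓝 A.toLinearMap.normDet) := by
    have : Continuous fun δ : ℝ => (1 - δ * κ) ^ finrank ℝ E * A.toLinearMap.normDet := by fun_prop
    simpa using (this.tendsto 0).mono_left nhdsWithin_le_nhds
  have hlim' : Tendsto (fun δ : ℝ => 1 - δ * κ) (𝓝[>] 0) (𝓝 1) := by
    have : Continuous fun δ : ℝ => 1 - δ * κ := by fun_prop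
    simpa using (this.tendsto 0).mono_left nhdsWithin_le_nhds
  obtain ⟨δ, ⟨hδ, hpos⟩, δ0⟩ := (((hlim.eventually_const_lt hm).and
    (hlim'.eventually_const_lt one_pos)).and self_mem_nhdsWithin).exists
  replace δ0 : 0 < δ := δ0
  refine ⟨.mk δ δ0.le, NNReal.coe_pos.1 δ0, fun s f hf => ?_⟩
  have hK : ∀ x ∈ s, ∀ y ∈ s, dist (A x) (A y) ≤
      (NNReal.mk (1 - δ * κ)⁻¹ (by positivity)) * dist (f x) (f y) := by
    intro x hx y hy
    change _ ≤ (1 - δ * κ)⁻¹ * _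
    rw [le_inv_mul_iff₀ hpos, dist_eq_norm, dist_eq_norm, ← map_sub]
    have h1 : ‖f x - f y - A (x - y)‖ ≤ δ * ‖x - y‖ := hf x hx y hy
    have h2 : ‖A (x - y)‖ ≤ ‖f x - f y‖ + ‖f x - f y - A (x - y)‖ := by
      calc ‖A (x - y)‖ = ‖(f x - f y) - (f x - f y - A (x - y))‖ := by abel_nf
        _ ≤ _ := norm_sub_le _ _
    have h3 : ‖x - y‖ ≤ κ * ‖A (x - y)‖ := by
      simpa [dist_eq_norm] using hκ.le_mul_dist x y
    nlinarith [mul_le_mul_of_nonneg_left h3 δ0.le]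
  have h := euclideanHausdorffMeasure_image_le_of_dist_le (finrank ℝ E) hK
  have hA := A.toLinearMap.euclideanHausdorffMeasure_image_eq_normDet_mul_volume s
  rw [ContinuousLinearMap.coe_coe] at hA
  rw [hA] at h
  set c : ℝ := (1 - δ * κ) ^ finrank ℝ E with hc
  have hc0 : 0 < c := by positivity
  calc ENNReal.ofReal m * volume s ≤ ENNReal.ofReal (c * A.toLinearMap.normDet) * volume s := by
        gcongr
    _ = ENNReal.ofReal c * (ENNReal.ofReal A.toLinearMap.normDet * volume s) := by
        rw [ENNReal.ofReal_mul hc0.le, mul_assoc]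
    _ ≤ ENNReal.ofReal c * (ENNReal.ofReal c⁻¹ * μHE[finrank ℝ E] (f '' s)) := by
        gcongr ENNReal.ofReal c * ?_
        refine h.trans_eq ?_
        rw [← ENNReal.ofReal_coe_nnreal, ← ENNReal.ofReal_pow (by positivity), hc, ← inv_pow]
        rfl
    _ = μHE[finrank ℝ E] (f '' s) := by
        rw [← mul_assoc, ← ENNReal.ofReal_mul hc0.le, mul_inv_cancel₀ hc0.ne', ENNReal.ofReal_one,
          one_mul]

/-- All the estimates needed for the area formula, for one linear map and one precision. -/
theorem exists_area_estimates (A : E →L[ℝ] F) {ε : ℝ} (hε : 0 < ε) :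
    ∃ δ > (0 : ℝ≥0),
      (∀ B : E →L[ℝ] F, ‖B - A‖ ≤ δ → |B.toLinearMap.normDet - A.toLinearMap.normDet| ≤ ε) ∧
      ∀ (s : Set E) (f : E → F), ApproximatesLinearOn f A s δ →
        μHE[finrank ℝ E] (f '' s) ≤ ENNReal.ofReal (A.toLinearMap.normDet + ε) * volume s ∧
        ENNReal.ofReal (A.toLinearMap.normDet - ε) * volume s ≤ μHE[finrank ℝ E] (f '' s) := by
  obtain ⟨δ₁, h₁, H₁⟩ := exists_euclideanHausdorffMeasure_image_le A (lt_add_of_pos_right _ hε)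
  obtain ⟨δ₂, h₂, H₂⟩ := exists_le_euclideanHausdorffMeasure_image A (sub_lt_self _ hε)
  obtain ⟨δ₃, h₃, H₃⟩ := Metric.continuousAt_iff.1
    ((continuous_normDet (E := E) (F := F)).continuousAt (x := A)) ε hε
  -- Halving turns the non-strict bound on `‖B - A‖` into the strict one that continuity requires.
  have h₃' : 0 < δ₃.toNNReal / 2 := by positivity
  refine ⟨min (min δ₁ δ₂) (δ₃.toNNReal / 2), by positivity, fun B hB => ?_, fun s f hf => ?_⟩
  · refine (H₃ ?_).le
    rw [dist_eq_norm]
    refine hB.trans_lt ?_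
    have : ((min (min δ₁ δ₂) (δ₃.toNNReal / 2) : ℝ≥0) : ℝ) ≤ δ₃ / 2 := by
      refine (NNReal.coe_le_coe.2 (min_le_right _ _)).trans ?_
      simp [h₃.le]
    linarith
  · exact ⟨H₁ s f (hf.mono_num ((min_le_left _ _).trans (min_le_left _ _))),
      H₂ s f (hf.mono_num ((min_le_left _ _).trans (min_le_right _ _)))⟩

end AreaEstimates

/-! ### The area formula and change of variables -/

section AreaFormula

variable {E F : Type*} [NormedAddCommGroup E] [InnerProductSpace ℝ E] [FiniteDimensional ℝ E]
  [MeasurableSpace E] [BorelSpace E] [NormedAddCommGroup F] [InnerProductSpace ℝ F]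
  [FiniteDimensional ℝ F] [MeasurableSpace F] [BorelSpace F]
  {s : Set E} {f : E → F} {f' : E → E →L[ℝ] F}

/-- On each piece one `ε` is lost in replacing `f` by `A n`, another in replacing `f' x` by `A n`.
-/
theorem area_formula_approx (hs : MeasurableSet s)
    (hf' : ∀ x ∈ s, HasFDerivWithinAt f (f' x) s x) (hf : InjOn f s) {ε : ℝ} (hε : 0 < ε) :
    μHE[finrank ℝ E] (f '' s) ≤ (∫⁻ x in s, ENNReal.ofReal (f' x).toLinearMap.normDet) +
        ENNReal.ofReal (2 * ε) * volume s ∧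
      ∫⁻ x in s, ENNReal.ofReal (f' x).toLinearMap.normDet ≤
        μHE[finrank ℝ E] (f '' s) + ENNReal.ofReal (2 * ε) * volume s := by
  choose δ δ0 hδ using fun A : E →L[ℝ] F => exists_area_estimates A hε
  obtain ⟨t, A, t_disj, t_meas, t_cover, ht, -⟩ :=
    exists_partition_approximatesLinearOn_of_hasFDerivWithinAt f s f' hf' δ fun A => (δ0 A).ne'
  have hT : s = ⋃ n, s ∩ t n := by
    rw [← inter_iUnion, inter_eq_left.2 t_cover]
  have hTm : ∀ n, MeasurableSet (s ∩ t n) := fun n => hs.inter (t_meas n)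
  have hTd : Pairwise (Disjoint on fun n => s ∩ t n) :=
    fun i j hij => (t_disj hij).mono inter_subset_right inter_subset_right
  have hfc : ContinuousOn f s := fun x hx => (hf' x hx).continuousWithinAt
  have him : μHE[finrank ℝ E] (f '' s) = ∑' n, μHE[finrank ℝ E] (f '' (s ∩ t n)) := by
    conv_lhs => rw [hT, image_iUnion]
    refine measure_iUnion (fun i j hij => ?_) fun n =>
      (hTm n).image_of_continuousOn_injOn (hfc.mono inter_subset_left) (hf.mono inter_subset_left)
    exact disjoint_image_image fun x hx y hy hxy =>
      (hTd hij).ne_of_mem hx hy (hf hx.1 hy.1 hxy)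
  have hint : ∫⁻ x in s, ENNReal.ofReal (f' x).toLinearMap.normDet =
      ∑' n, ∫⁻ x in s ∩ t n, ENNReal.ofReal (f' x).toLinearMap.normDet := by
    conv_lhs => rw [hT]
    exact lintegral_iUnion hTm hTd _
  have hvol : volume s = ∑' n, volume (s ∩ t n) := by
    conv_lhs => rw [hT]
    exact measure_iUnion hTd hTm
  have hae : ∀ n, ∀ᵐ x ∂volume.restrict (s ∩ t n),
      |(f' x).toLinearMap.normDet - (A n).toLinearMap.normDet| ≤ ε := by
    intro n
    filter_upwards [ae_tangentConeAt_eq_univ volume (s ∩ t n), ae_restrict_mem (hTm n)] with x hx hxs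
    exact (hδ (A n)).1 _ (norm_fderiv_sub_le_of_tangentConeAt_eq_univ hx hxs (ht n)
      ((hf' x hxs.1).mono inter_subset_left))
  rw [him, hint, hvol, ← ENNReal.tsum_mul_left, ← ENNReal.tsum_add, ← ENNReal.tsum_add]
  refine ⟨ENNReal.tsum_le_tsum fun n => ?_, ENNReal.tsum_le_tsum fun n => ?_⟩
  · refine ((hδ (A n)).2 _ f (ht n)).1.trans ?_
    rw [← setLIntegral_const, ← setLIntegral_const, ← lintegral_add_right _ measurable_const]
    refine lintegral_mono_ae ?_
    filter_upwards [hae n] with x hx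
    rw [← ENNReal.ofReal_add (LinearMap.normDet_nonneg _) (by positivity)]
    refine ENNReal.ofReal_le_ofReal ?_
    linarith [(abs_le.1 hx).1]
  · calc ∫⁻ x in s ∩ t n, ENNReal.ofReal (f' x).toLinearMap.normDet
        ≤ ∫⁻ _ in s ∩ t n,
          (ENNReal.ofReal ((A n).toLinearMap.normDet - ε) + ENNReal.ofReal (2 * ε)) := by
          refine lintegral_mono_ae ?_
          filter_upwards [hae n] with x hx
          -- `normDet - ε` may be negative, so only subadditivity of `ENNReal.ofReal` is available.
          refine le_trans (ENNReal.ofReal_le_ofReal ?_) ENNReal.ofReal_add_le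
          linarith [(abs_le.1 hx).2]
      _ ≤ _ := by
          rw [setLIntegral_const, add_mul]
          gcongr
          exact ((hδ (A n)).2 _ f (ht n)).2

theorem lintegral_normDet_eq_euclideanHausdorffMeasure_image_of_ne_top (hs : MeasurableSet s)
    (hfin : volume s ≠ ∞) (hf' : ∀ x ∈ s, HasFDerivWithinAt f (f' x) s x) (hf : InjOn f s) :
    ∫⁻ x in s, ENNReal.ofReal (f' x).toLinearMap.normDet = μHE[finrank ℝ E] (f '' s) := by
  have hlim : ∀ a : ℝ≥0∞, Tendsto (fun ε : ℝ => a + ENNReal.ofReal (2 * ε) * volume s)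
      (𝓝[>] 0) (𝓝 a) := by
    intro a
    have h1 : Tendsto (fun ε : ℝ => ENNReal.ofReal (2 * ε)) (𝓝[>] 0) (𝓝 0) := by
      have : Continuous fun ε : ℝ => ENNReal.ofReal (2 * ε) :=
        ENNReal.continuous_ofReal.comp (by fun_prop)
      simpa using (this.tendsto 0).mono_left nhdsWithin_le_nhds
    simpa using tendsto_const_nhds.add (ENNReal.Tendsto.mul_const h1 (Or.inr hfin))
  refine le_antisymm (ge_of_tendsto (hlim _) ?_) (ge_of_tendsto (hlim _) ?_)
  · filter_upwards [self_mem_nhdsWithin] with ε hε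
    exact (area_formula_approx hs hf' hf hε).2
  · filter_upwards [self_mem_nhdsWithin] with ε hε
    exact (area_formula_approx hs hf' hf hε).1

/-- **Area formula**: the measure of the image of a set by an injective differentiable map. -/
theorem lintegral_normDet_eq_euclideanHausdorffMeasure_image (hs : MeasurableSet s)
    (hf' : ∀ x ∈ s, HasFDerivWithinAt f (f' x) s x) (hf : InjOn f s) :
    ∫⁻ x in s, ENNReal.ofReal (f' x).toLinearMap.normDet = μHE[finrank ℝ E] (f '' s) := by
  let u : ℕ → Set E := disjointed (spanningSets volume)
  have hu : ∀ n, MeasurableSet (u n) := .disjointed (measurableSet_spanningSets _)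
  have hT : s = ⋃ n, s ∩ u n := by
    rw [← inter_iUnion, iUnion_disjointed, iUnion_spanningSets, inter_univ]
  have hTm : ∀ n, MeasurableSet (s ∩ u n) := fun n => hs.inter (hu n)
  have hTd : Pairwise (Disjoint on fun n => s ∩ u n) := fun i j hij =>
    (disjoint_disjointed (spanningSets (volume : Measure E)) hij).mono
      inter_subset_right inter_subset_right
  have hfc : ContinuousOn f s := fun x hx => (hf' x hx).continuousWithinAt
  conv_lhs => rw [hT]
  conv_rhs => rw [hT, image_iUnion]
  rw [lintegral_iUnion hTm hTd, measure_iUnion]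
  · refine tsum_congr fun n => ?_
    refine lintegral_normDet_eq_euclideanHausdorffMeasure_image_of_ne_top (hTm n) ?_
      (fun x hx => (hf' x hx.1).mono inter_subset_left) (hf.mono inter_subset_left)
    exact ((measure_mono (inter_subset_right.trans (disjointed_subset _ _))).trans_lt
      (measure_spanningSets_lt_top volume n)).ne
  · exact fun i j hij => disjoint_image_image fun x hx y hy hxy =>
      (hTd hij).ne_of_mem hx hy (hf hx.1 hy.1 hxy)
  · exact fun n => (hTm n).image_of_continuousOn_injOn (hfc.mono inter_subset_left)
      (hf.mono inter_subset_left)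

/-- The area formula for a Lipschitz map on a null measurable set. -/
theorem LipschitzOnWith.lintegral_normDet_eq_euclideanHausdorffMeasure_image {K : ℝ≥0}
    (hs : NullMeasurableSet s) (hK : LipschitzOnWith K f s)
    (hf' : ∀ᵐ x ∂volume.restrict s, HasFDerivWithinAt f (f' x) s x) (hf : InjOn f s) :
    ∫⁻ x in s, ENNReal.ofReal (f' x).toLinearMap.normDet = μHE[finrank ℝ E] (f '' s) := by
  let S : Set E := {x | x ∈ s ∧ HasFDerivWithinAt f (f' x) s x}
  have hSs : S =ᵐ[volume] s := by
    rw [ae_restrict_iff'₀ hs] at hf'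
    filter_upwards [hf'] with x hx
    exact propext ⟨fun h => h.1, fun h => ⟨h, hx h⟩⟩
  -- Discard a null set to reach a measurable set of differentiability points; the Lipschitz bound
  -- makes the image of the discarded part null.
  obtain ⟨t, tS, ht, htS⟩ := (hs.congr hSs.symm).exists_measurable_subset_ae_eq
  have ts : t ⊆ s := fun x hx => (tS hx).1
  have hts : t =ᵐ[volume] s := htS.trans hSs
  have hnull : μHE[finrank ℝ E] (f '' (s \ t)) = 0 := by
    refine le_antisymm (((hK.mono sdiff_subset).euclideanHausdorffMeasure_image_le _).trans ?_) bot_le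
    rw [InnerProductSpace.euclideanHausdorffMeasure_eq_volume, (ae_eq_set.1 hts).2, mul_zero]
  have h1 : μHE[finrank ℝ E] (f '' s) = μHE[finrank ℝ E] (f '' t) := by
    refine le_antisymm ?_ (measure_mono (image_mono ts))
    calc μHE[finrank ℝ E] (f '' s) = μHE[finrank ℝ E] (f '' t ∪ f '' (s \ t)) := by
          rw [← image_union, union_sdiff_cancel ts]
      _ ≤ _ := (measure_union_le _ _).trans_eq (by rw [hnull, add_zero])
  rw [h1, setLIntegral_congr hts.symm]
  exact _root_.lintegral_normDet_eq_euclideanHausdorffMeasure_image ht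
    (fun x hx => (tS hx).2.mono ts) (hf.mono ts)

/-- The area formula, applied to each `f ⁻¹' t ∩ s`. -/
theorem LipschitzOnWith.map_withDensity_normDet {K : ℝ≥0}
    (hs : NullMeasurableSet s) (hK : LipschitzOnWith K f s)
    (hf' : ∀ᵐ x ∂volume.restrict s, HasFDerivWithinAt f (f' x) s x) (hf : InjOn f s) :
    Measure.map f ((volume.restrict s).withDensity
        fun x => ENNReal.ofReal (f' x).toLinearMap.normDet) =
      μHE[finrank ℝ E].restrict (f '' s) := by
  have h'f : AEMeasurable f (volume.restrict s) := hK.continuousOn.aemeasurable₀ hs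
  have h''f : AEMeasurable f ((volume.restrict s).withDensity
      fun x => ENNReal.ofReal (f' x).toLinearMap.normDet) :=
    h'f.mono_ac (withDensity_absolutelyContinuous _ _)
  refine Measure.ext fun t ht => ?_
  have h't : NullMeasurableSet (f ⁻¹' t) (volume.restrict s) := h'f.nullMeasurableSet_preimage ht
  rw [Measure.map_apply_of_aemeasurable h''f ht, withDensity_apply₀ _ h't,
    Measure.restrict_apply ht, Measure.restrict_restrict₀ h't,
    (hK.mono inter_subset_right).lintegral_normDet_eq_euclideanHausdorffMeasure_image
      ((nullMeasurableSet_restrict hs).1 h't) ?_ (hf.mono inter_subset_right), image_preimage_inter]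
  filter_upwards [ae_mono (Measure.restrict_mono inter_subset_right le_rfl) hf'] with x hx
  exact hx.mono inter_subset_right

omit [MeasurableSpace F] [BorelSpace F] in
theorem LipschitzOnWith.ae_uniqueDiffWithinAt_and_differentiableWithinAt {K : ℝ≥0}
    (hs : NullMeasurableSet s) (hK : LipschitzOnWith K f s) :
    ∀ᵐ x ∂volume.restrict s, UniqueDiffWithinAt ℝ s x ∧ DifferentiableWithinAt ℝ f s x := by
  have h : ∀ᵐ x ∂volume.restrict s, DifferentiableWithinAt ℝ f s x := by
    rw [ae_restrict_iff'₀ hs]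
    exact hK.ae_differentiableWithinAt_of_mem
  filter_upwards [h, ae_tangentConeAt_eq_univ volume s] with x hx hx'
  exact ⟨uniqueDiffWithinAt_of_tangentConeAt_eq_univ hx', hx⟩

-- A Lipschitz extension to all of `E` has a measurable `fderiv`, which agrees with `fderivWithin`
-- wherever the latter is unique and the extension is differentiable.
omit [MeasurableSpace F] [BorelSpace F] in
theorem LipschitzOnWith.aemeasurable_fderivWithin {K : ℝ≥0}
    (hs : NullMeasurableSet s) (hK : LipschitzOnWith K f s) :
    AEMeasurable (fderivWithin ℝ f s) (volume.restrict s) := by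
  obtain ⟨g, hg, hfg⟩ := hK.extend_finite_dimension
  refine ⟨fderiv ℝ g, measurable_fderiv ℝ g, ?_⟩
  filter_upwards [hK.ae_uniqueDiffWithinAt_and_differentiableWithinAt hs, ae_restrict_mem₀ hs,
    ae_restrict_of_ae (hg.ae_differentiableAt (μ := volume))] with x hx hxs hgx
  rw [fderivWithin_congr hfg (hfg hxs), fderivWithin_eq_fderiv hx.1 hgx]

/-- Change of variables for a Lipschitz injective parameterization: integrability. -/
theorem LipschitzOnWith.integrable_image_iff {K : ℝ≥0}
    (hs : NullMeasurableSet s) (hK : LipschitzOnWith K f s) (hf : InjOn f s) {g : F → ℝ}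
    (hg : AEStronglyMeasurable g (μHE[finrank ℝ E].restrict (f '' s))) :
    IntegrableOn g (f '' s) μHE[finrank ℝ E] ↔
      IntegrableOn (fun x => (fderivWithin ℝ f s x).toLinearMap.normDet * g (f x)) s := by
  have hd : ∀ᵐ x ∂volume.restrict s, HasFDerivWithinAt f (fderivWithin ℝ f s x) s x :=
    (hK.ae_uniqueDiffWithinAt_and_differentiableWithinAt hs).mono fun x hx =>
      hx.2.hasFDerivWithinAt
  have hmap := hK.map_withDensity_normDet hs hd hf
  have hJ : AEMeasurable (fun x => ENNReal.ofReal (fderivWithin ℝ f s x).toLinearMap.normDet)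
      (volume.restrict s) :=
    (continuous_normDet.measurable.comp_aemeasurable (hK.aemeasurable_fderivWithin hs)).ennreal_ofReal
  have hfm := (hK.continuousOn.aemeasurable₀ hs).mono_ac (withDensity_absolutelyContinuous _
    fun x => ENNReal.ofReal (fderivWithin ℝ f s x).toLinearMap.normDet)
  rw [IntegrableOn, ← hmap, integrable_map_measure (hmap ▸ hg) hfm,
    integrable_withDensity_iff_integrable_smul₀' hJ (by simp), IntegrableOn]
  simp [ENNReal.toReal_ofReal (LinearMap.normDet_nonneg _)]

/-- Change of variables for a Lipschitz injective parameterization: value of the integral. -/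
theorem LipschitzOnWith.setIntegral_image {K : ℝ≥0}
    (hs : NullMeasurableSet s) (hK : LipschitzOnWith K f s) (hf : InjOn f s) {g : F → ℝ}
    (hg : AEStronglyMeasurable g (μHE[finrank ℝ E].restrict (f '' s))) :
    ∫ y in f '' s, g y ∂μHE[finrank ℝ E] =
      ∫ x in s, (fderivWithin ℝ f s x).toLinearMap.normDet * g (f x) := by
  have hd : ∀ᵐ x ∂volume.restrict s, HasFDerivWithinAt f (fderivWithin ℝ f s x) s x :=
    (hK.ae_uniqueDiffWithinAt_and_differentiableWithinAt hs).mono fun x hx =>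
      hx.2.hasFDerivWithinAt
  have hmap := hK.map_withDensity_normDet hs hd hf
  have hJ : AEMeasurable (fun x => ENNReal.ofReal (fderivWithin ℝ f s x).toLinearMap.normDet)
      (volume.restrict s) :=
    (continuous_normDet.measurable.comp_aemeasurable (hK.aemeasurable_fderivWithin hs)).ennreal_ofReal
  have hfm := (hK.continuousOn.aemeasurable₀ hs).mono_ac (withDensity_absolutelyContinuous _
    fun x => ENNReal.ofReal (fderivWithin ℝ f s x).toLinearMap.normDet)
  rw [← hmap, integral_map hfm (hmap ▸ hg),
    integral_withDensity_eq_integral_toReal_smul₀ hJ (by simp)]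
  simp [ENNReal.toReal_ofReal (LinearMap.normDet_nonneg _)]

end AreaFormula

/-! ### Positivity and finiteness of the surface measure -/

theorem volume_inter_halfSpace_ne_zero {p : ℕ} {V : Set (Euc p)} (hV : IsOpen V) {a y : Euc p}
    (hy : y ∈ V ∩ {y | 0 ≤ inner ℝ a y}) : volume (V ∩ {y : Euc p | 0 ≤ inner ℝ a y}) ≠ 0 := by
  rcases eq_or_ne a 0 with rfl | ha
  · simpa using hV.measure_ne_zero volume ⟨y, hy.1⟩
  have hopen : IsOpen (V ∩ {z : Euc p | 0 < inner ℝ a z}) :=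
    hV.inter (isOpen_lt continuous_const (by fun_prop))
  -- A boundary point is pushed slightly in direction `a` into the open half-space.
  have hne : (V ∩ {z : Euc p | 0 < inner ℝ a z}).Nonempty := by
    have hc : Tendsto (fun t : ℝ => y + t • a) (𝓝[>] 0) (𝓝 y) := by
      have : Continuous fun t : ℝ => y + t • a := by fun_prop
      simpa using (this.tendsto 0).mono_left nhdsWithin_le_nhds
    obtain ⟨t, ht, ht0⟩ := ((hc.eventually (hV.mem_nhds hy.1)).and self_mem_nhdsWithin).exists
    replace ht0 : 0 < t := ht0
    refine ⟨y + t • a, ht, ?_⟩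
    have h0 : 0 ≤ inner ℝ a y := hy.2
    have h1 : 0 < ‖a‖ := norm_pos_iff.2 ha
    rw [mem_ofPred, inner_add_right, inner_smul_right, real_inner_self_eq_norm_sq]
    positivity
  refine fun h0 => hopen.measure_ne_zero volume hne (measure_mono_null ?_ h0)
  exact inter_subset_inter_right _ fun z (hz : 0 < inner ℝ a z) => hz.le

theorem IsLipschitzManifold.euclideanHausdorffMeasure_ne_zero {d p : ℕ} {C : Set (Euc d)}
    (hC : IsLipschitzManifold p C) (hne : C.Nonempty) : μHE[p] C ≠ 0 := by
  obtain ⟨x, hx⟩ := hne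
  obtain ⟨U, V, a, ψ, K, L, -, hxU, hV, him, hψ⟩ := hC x hx
  obtain ⟨y, hy, -⟩ : x ∈ ψ '' (V ∩ {y | 0 ≤ inner ℝ a y}) := him ▸ ⟨hx, hxU⟩
  intro h0
  have h1 : μHE[p] (ψ '' (V ∩ {y | 0 ≤ inner ℝ a y})) = 0 :=
    measure_mono_null (him ▸ inter_subset_left) h0
  have h2 := euclideanHausdorffMeasure_image_le_of_dist_le (f := id) (g := ψ) p
    fun y hy z hz => (hψ y hy z hz).2
  rw [image_id, h1, mul_zero, EuclideanSpace.euclideanHausdorffMeasure_eq_volume] at h2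
  exact volume_inter_halfSpace_ne_zero hV hy (le_antisymm h2 bot_le)

theorem IsLipschitzManifold.euclideanHausdorffMeasure_ne_top {d p : ℕ} {C : Set (Euc d)}
    (hC : IsLipschitzManifold p C) (hCc : IsCompact C) : μHE[p] C ≠ ∞ := by
  refine (hCc.measure_lt_top_of_nhdsWithin fun x hx => ?_).ne
  obtain ⟨U, V, a, ψ, K, L, hU, hxU, -, him, hψ⟩ := hC x hx
  set S := V ∩ {y | 0 ≤ inner ℝ a y}
  refine ⟨C ∩ (U ∩ ball x 1), inter_mem_nhdsWithin _ ((hU.inter isOpen_ball).mem_nhds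
    ⟨hxU, mem_ball_self one_pos⟩), ?_⟩
  have hT : C ∩ (U ∩ ball x 1) = ψ '' (S ∩ ψ ⁻¹' ball x 1) := by
    rw [image_inter_preimage, him, inter_assoc]
  -- The chart domain may be unbounded; the Lipschitz inverse makes the part over a unit ball
  -- bounded, hence of finite volume.
  have hbdd : Bornology.IsBounded (S ∩ ψ ⁻¹' ball x 1) := by
    refine Metric.isBounded_iff.2 ⟨L * 2, fun y hy z hz => ((hψ y hy.1 z hz.1).2).trans ?_⟩
    gcongr
    have h1 : dist (ψ y) x < 1 := hy.2
    have h2 : dist (ψ z) x < 1 := hz.2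
    linarith [dist_triangle_right (ψ y) (ψ z) x]
  have h := euclideanHausdorffMeasure_image_le_of_dist_le (f := ψ) (g := id)
    (s := S ∩ ψ ⁻¹' ball x 1) p fun y hy z hz => (hψ y hy.1 z hz.1).1
  rw [image_id, EuclideanSpace.euclideanHausdorffMeasure_eq_volume] at h
  rw [hT]
  exact h.trans_lt (ENNReal.mul_lt_top (by simp) hbdd.measure_lt_top)

theorem isProbabilityMeasure_normalizedSurfaceMeasure {d : ℕ} {C : Set (Euc d)}
    (h0 : μHE[d - 1] C ≠ 0) (h1 : μHE[d - 1] C ≠ ∞) :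
    IsProbabilityMeasure (normalizedSurfaceMeasure C) :=
  ⟨by simp [normalizedSurfaceMeasure, ENNReal.inv_mul_cancel h0 h1]⟩

/-! ### The lifting formula -/

theorem sqrt_det_jacobianMatrix {d p : ℕ} (γ : Euc p → Euc d) (Γ : Set (Euc p)) (s : Euc p) :
    √((jacobianMatrix γ Γ s)ᵀ * jacobianMatrix γ Γ s).det =
      (fderivWithin ℝ γ Γ s).toLinearMap.normDet := by
  have h := (fderivWithin ℝ γ Γ s).toLinearMap.normDet_sq_eq_det_gram
    (EuclideanSpace.basisFun (Fin p) ℝ)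
  rw [RCLike.ofReal_real_eq_id, id] at h
  -- `JᵀJ` is the Gram matrix of the images of the standard basis.
  have hm : (jacobianMatrix γ Γ s)ᵀ * jacobianMatrix γ Γ s =
      Matrix.gram ℝ fun i => (fderivWithin ℝ γ Γ s).toLinearMap
        (EuclideanSpace.basisFun (Fin p) ℝ i) := by
    ext i j
    simp [Matrix.mul_apply, jacobianMatrix, Matrix.gram, PiLp.inner_apply, mul_comm]
  rw [hm, ← h, Real.sqrt_sq (LinearMap.normDet_nonneg _)]

theorem surfaceIntegrand_eq {d p : ℕ} (G : Euc d → Euc d → ℝ) (C : Set (Euc d)) (φ : Euc d → ℝ)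
    (Γ : Set (Euc p)) (γ : Euc p → Euc d) (x : Euc d) :
    surfaceIntegrand G C φ Γ γ x = fun s => (μHE[d - 1] C).toReal⁻¹ *
      ((fderivWithin ℝ γ Γ s).toLinearMap.normDet * (G x (γ s) * φ (γ s))) := by
  ext s
  rw [surfaceIntegrand, sqrt_det_jacobianMatrix]
  ring

theorem IsInjLipschitzParam.integrableOn_and_integral {p : ℕ} {C : Set (Euc (p + 1))}
    {Γ : Set (Euc p)} {γ : Euc p → Euc (p + 1)} (hγ : IsInjLipschitzParam C Γ γ)
    (h0 : μHE[p] C ≠ 0) (h1 : μHE[p] C ≠ ∞) {G : Euc (p + 1) → Euc (p + 1) → ℝ}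
    {φ : Euc (p + 1) → ℝ} {x : Euc (p + 1)}
    (hi : Integrable (fun y => G x y * φ y) (normalizedSurfaceMeasure C)) :
    IntegrableOn (surfaceIntegrand G C φ Γ γ x) Γ volume ∧
      ∫ y, G x y * φ y ∂normalizedSurfaceMeasure C =
        ∫ s in Γ, surfaceIntegrand G C φ Γ γ x s := by
  obtain ⟨K, hK⟩ := hγ.lipschitz
  have hfr : finrank ℝ (Euc p) = p := finrank_euclideanSpace_fin
  have hν : normalizedSurfaceMeasure C = (μHE[p] C)⁻¹ • (μHE[p]).restrict C := rfl
  rw [hν, integrable_smul_measure (ENNReal.inv_ne_zero.2 h1) (ENNReal.inv_ne_top.2 h0)] at hi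
  have him : (μHE[p] : Measure (Euc (p + 1))).restrict C =
      (μHE[finrank ℝ (Euc p)]).restrict (γ '' Γ) := by
    rw [hγ.image_eq, hfr]
  rw [him] at hi
  have hiff := hK.integrable_image_iff hγ.measurable_domain hγ.injOn hi.aestronglyMeasurable
  have heq := hK.setIntegral_image hγ.measurable_domain hγ.injOn hi.aestronglyMeasurable
  rw [surfaceIntegrand_eq]
  refine ⟨(hiff.1 hi).const_mul _, ?_⟩
  rw [hν, integral_smul_measure, him, heq, integral_const_mul, ENNReal.toReal_inv, smul_eq_mul]
  rfl

/-- `G x` is bounded on the compact `C`, and `L²` lies in `L¹` for a probability measure. -/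
theorem IsContinuousCovarianceKernelOn.integrable_mul {d : ℕ} {G : Euc d → Euc d → ℝ}
    {D C : Set (Euc d)} (hG : IsContinuousCovarianceKernelOn G D) (hCc : IsCompact C) (hCD : C ⊆ D)
    [IsProbabilityMeasure (normalizedSurfaceMeasure C)] {φ : Euc d → ℝ}
    (hφ : MemLp φ 2 (normalizedSurfaceMeasure C)) {x : Euc d} (hx : x ∈ D) :
    Integrable (fun y => G x y * φ y) (normalizedSurfaceMeasure C) := by
  have hc : ContinuousOn (G x) C :=
    hG.continuousOn.comp (f := fun y => (x, y)) (by fun_prop) fun y hy => ⟨hx, hCD hy⟩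
  obtain ⟨M, hM⟩ := hCc.exists_bound_of_continuousOn hc
  refine (hφ.integrable (by norm_num)).bdd_mul (c := M) ?_ ?_
  · exact (hc.aestronglyMeasurable hCc.measurableSet).smul_measure _
  · exact Measure.ae_smul_measure ((ae_restrict_mem hCc.measurableSet).mono hM) _

theorem corollary2 {d p : ℕ} (hdp : d = p + 1)
    -- the domain, the continuous covariance kernel, and the compact manifold in the domain
    (D : Set (Euc d)) (G : Euc d → Euc d → ℝ) (hG : IsContinuousCovarianceKernelOn G D)
    (C : Set (Euc d)) (hCne : C.Nonempty) (hCc : IsCompact C) (hCD : C ⊆ D)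
    (hC : IsLipschitzManifold (d - 1) C) :
    -- the normalized surface measure is a probability measure
    IsProbabilityMeasure (normalizedSurfaceMeasure C) ∧
    -- the Jacobian matrix of a parameterization is well defined almost everywhere
    (∀ (Γ : Set (Euc p)) (γ : Euc p → Euc d), IsInjLipschitzParam C Γ γ →
      ∀ᵐ s ∂volume.restrict Γ, UniqueDiffWithinAt ℝ Γ s ∧ DifferentiableWithinAt ℝ γ Γ s) ∧
    ∀ {ι : Type*} (lam : ι → ℝ) (φ : ι → Euc d → ℝ),
      IsOrthonormalEigensystem G (normalizedSurfaceMeasure C) lam φ →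
      -- the formula for the liftings, in which all the integrals converge
      (∀ (Γ : Set (Euc p)) (γ : Euc p → Euc d), IsInjLipschitzParam C Γ γ →
        ∀ n, ∀ x ∈ D,
          Integrable (fun y => G x y * φ n y) (normalizedSurfaceMeasure C) ∧
          IntegrableOn (surfaceIntegrand G C (φ n) Γ γ x) Γ volume ∧
          lifting G (normalizedSurfaceMeasure C) (lam n) (φ n) x
            = 1 / lam n * ∫ s in Γ, surfaceIntegrand G C (φ n) Γ γ x s) ∧
      -- the value does not depend on the parameterization
      (∀ (Γ₁ Γ₂ : Set (Euc p)) (γ₁ γ₂ : Euc p → Euc d),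
        IsInjLipschitzParam C Γ₁ γ₁ → IsInjLipschitzParam C Γ₂ γ₂ →
        ∀ n, ∀ x ∈ D,
          1 / lam n * ∫ s in Γ₁, surfaceIntegrand G C (φ n) Γ₁ γ₁ x s
            = 1 / lam n * ∫ s in Γ₂, surfaceIntegrand G C (φ n) Γ₂ γ₂ x s) := by
  subst hdp
  have h0 := hC.euclideanHausdorffMeasure_ne_zero hCne
  have h1 := hC.euclideanHausdorffMeasure_ne_top hCc
  have hprob := isProbabilityMeasure_normalizedSurfaceMeasure h0 h1
  refine ⟨hprob, fun Γ γ hγ => ?_, fun lam φ hφ => ?_⟩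
  · obtain ⟨K, hK⟩ := hγ.lipschitz
    exact hK.ae_uniqueDiffWithinAt_and_differentiableWithinAt hγ.measurable_domain
  have hint := fun n x (hx : x ∈ D) => hG.integrable_mul hCc hCD (hφ.memLp n) hx
  refine ⟨fun Γ γ hγ n x hx => ?_, fun Γ₁ Γ₂ γ₁ γ₂ hγ₁ hγ₂ n x hx => ?_⟩
  · obtain ⟨hI, h2⟩ := hγ.integrableOn_and_integral h0 h1 (hint n x hx)
    exact ⟨hint n x hx, hI, by rw [lifting, h2]⟩
  · rw [← (hγ₁.integrableOn_and_integral h0 h1 (hint n x hx)).2,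
      ← (hγ₂.integrableOn_and_integral h0 h1 (hint n x hx)).2]
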